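/- Let $K$ be a division ring, let $G$ be a finitely generated amenable group, and let $K*G$ be a crossed product, given by maps $\sigma:G\to\mathrm{Aut}_{\mathrm{ring}}(K)$ and $\rho:G\times G\to K^\times$ such that, for all $g_1,g_2,g_3,g\in G$ and $r\in K$, $$\rho(g_1,g_2)\rho(g_1g_2,g_3)=\sigma_{g_1}(\rho(g_2,g_3))\,\rho(g_1,g_2g_3),\qquad \sigma_{g_1}(\sigma_{g_2}(r))=\rho(g_1,g_2)\,\sigma_{g_1g_2}(r)\,\rho(g_1,g_2)^{-1},$$ $\rho(g,e)=\rho(e,g)=1$ and $\sigma_e=\mathrm{id}$. That is, $K*G$ is the ring of finite formal sums $\sum_{g\in G} r_g\underline g$ with $r_g\in K$, with componentwise addition and with the biadditive product determined by $(r\underline g)(s\underline h)=r\,\sigma_g(s)\,\rho(g,h)\,\underline{gh}$. Left $K*G$-modules are regarded as left $K$-vector spaces along $r\mapsto r\underline e$. A Følner sequence of $G$ is a sequence $(F_n)_{n\in\mathbb N}$ of nonempty finite subsets of $G$ such that $|\partial_C(F_n)|/|F_n|\to 0$ for every finite $C\subseteq G$, where $\partial_C(A)=\{x\in G: xC\cap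 A\ne\emptyset\text{ and } xC\not\subseteq A\}$; a Følner net is defined in the same way with a net $(F_i)_{i\in I}$ indexed by a directed set $I$, and $G$ is amenable if it has a Følner net. For a left $K*G$-module $M$ and a finite dimensional $K$-subspace $V\le M$ put $$\mathrm{ent}_{\dim}(M,V)=\lim_{n\to\infty}\frac{\dim_K\big(\sum_{g\in F_n}\underline g V\big)}{|F_n|},\qquad \mathrm{ent}_{\dim}(M)=\sup_V\ \mathrm{ent}_{\dim}(M,V)\in[0,\infty],$$ where $(F_n)$ is a Følner sequence of $G$ and the supremum is over all finite dimensional $K$-subspaces $V$ of $M$. Then $G$ has a Følner sequence, the limits above exist, are finite and do not depend on the choice of the Følner sequence, and the following are equivalent: 1. $K*G$ is a left and right Ore domain, i.e. a domain in which $Dx\cap Dy\neq 0$ and $xD\cap yD\ne 0$ for all nonzero $x,y\in D=K*G$; 2. $K*G$ is a domain; 3. $\mathrm{ent}_{\dim}((K*G)/I)=0$ for every nonzero left ideal $I$ of $K*G$; 4. $\mathrm{ent}_{\dim}(M)\in\mathbb N\cup\{\infty\}$ for every left $K*G$-module $M$; 5. the set of values $\mathrm{ent}_{\dim}(M)$,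 for $M$ ranging over the left $K*G$-modules, is exactly $\mathbb N\cup\{\infty\}$. -/

import Mathlib

open Filter Topology
open scoped ENNReal NNReal

universe u v w

/-! ## Amenable groups -/

section Amenable

variable {G : Type v} [Group G]

/-- The `C`-interior of `A`: all `x` with `x C ⊆ A`. -/
def cInterior (C A : Finset G) : Set G := {x | ∀ c ∈ C, x * c ∈ A}

/-- The `C`-exterior of `A`: all `x` such that `x C` meets `A`. -/
def cExterior (C A : Finset G) : Set G := {x | ∃ c ∈ C, x * c ∈ A}

/-- The `C`-boundary of `A`. -/
def cBoundary (C A : Finset G) : Set G := cExterior C A \ cInterior C A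

/-- The `C`-boundary of a finite set is finite, so its `Set.ncard` is its number of elements. -/
theorem cBoundary_finite (C A : Finset G) : (cBoundary C A).Finite := by
  classical
  refine ((A ×ˢ C).image fun p : G × G => p.1 * p.2⁻¹).finite_toSet.subset ?_
  rintro x ⟨⟨c, hc, hx⟩, -⟩
  simp only [Finset.coe_image, Set.mem_image, Finset.mem_coe, Finset.mem_product, Prod.exists]
  exact ⟨x * c, c, ⟨hx, hc⟩, by simp⟩

/-- A Følner net: a net of nonempty finite subsets `F i` with `|∂_C (F i)| / |F i| → 0` for every
finite `C`. A Følner sequence is the case `I = ℕ`. -/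
structure IsFolnerNet {I : Type*} [Preorder I] (F : I → Finset G) : Prop where
  nonempty : ∀ i, (F i).Nonempty
  tendsto_boundary : ∀ C : Finset G,
    Tendsto (fun i => ((cBoundary C (F i)).ncard : ℝ) / ((F i).card : ℝ)) atTop (𝓝 0)

end Amenable

/-- A group is amenable if it has a Følner net, indexed by some (nonempty) directed set. -/
def IsAmenableGroup (G : Type v) [Group G] : Prop :=
  ∃ (I : Type v) (_ : Preorder I) (_ : IsDirectedOrder I) (_ : Nonempty I) (F : I → Finset G),
    IsFolnerNet F

/-! ## Crossed products -/

/-- The data `σ : G → Aut R` and `ρ : G × G → U(R)` defining a crossed product of `R` with `G`. -/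
structure CrossedSystem (R : Type u) [Ring R] (G : Type v) [Group G] where
  σ : G → RingAut R
  ρ : G → G → Rˣ
  cross_one : ∀ g₁ g₂ g₃ : G,
    (ρ g₁ g₂ : R) * (ρ (g₁ * g₂) g₃ : R) = σ g₁ (ρ g₂ g₃ : R) * (ρ g₁ (g₂ * g₃) : R)
  cross_two : ∀ (g₁ g₂ : G) (r : R),
    σ g₁ (σ g₂ r) = (ρ g₁ g₂ : R) * σ (g₁ * g₂) r * ((ρ g₁ g₂)⁻¹ : Rˣ)
  ρ_one_right : ∀ g : G, ρ g 1 = 1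
  ρ_one_left : ∀ g : G, ρ 1 g = 1
  σ_one : σ 1 = 1

/-- The crossed product `R * G`: the formal sums `∑ r_g g̲`, encoded by their coefficients. -/
def CrossedProduct {R : Type u} [Ring R] {G : Type v} [Group G] (_c : CrossedSystem R G) :
    Type (max u v) :=
  G →₀ R

namespace CrossedProduct

variable {R : Type u} [Ring R] {G : Type v} [Group G] {c : CrossedSystem R G}

noncomputable instance instAddCommGroup : AddCommGroup (CrossedProduct c) := inferInstanceAs (AddCommGroup (G →₀ R))

/-- Left multiplication of the coefficients by elements of `R`. -/
noncomputable instance instModule : Module R (CrossedProduct c) := inferInstanceAs (Module R (G →₀ R))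

/-- The element `r g̲` of the crossed product. -/
noncomputable def monomial (c : CrossedSystem R G) (g : G) (r : R) : CrossedProduct c :=
  (Finsupp.single g r : G →₀ R)

/-- The element `g̲` of the crossed product. -/
noncomputable def of (c : CrossedSystem R G) (g : G) : CrossedProduct c := monomial c g 1

/-- `(∑ r_g g̲) (∑ s_h h̲) = ∑ r_g σ_g(s_h) ρ(g,h) (gh)̲`. -/
noncomputable instance instMul : Mul (CrossedProduct c) where
  mul x y := Finsupp.sum x fun g r => Finsupp.sum y fun h s =>
    monomial c (g * h) (r * c.σ g s * (c.ρ g h : R))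

noncomputable instance instOne : One (CrossedProduct c) := ⟨of c 1⟩

theorem mul_def (x y : CrossedProduct c) :
    x * y = Finsupp.sum x fun g r => Finsupp.sum y fun h s =>
      monomial c (g * h) (r * c.σ g s * (c.ρ g h : R)) := rfl

theorem one_def : (1 : CrossedProduct c) = monomial c 1 1 := rfl

@[simp] theorem monomial_zero (g : G) : monomial c g 0 = 0 := Finsupp.single_zero g

theorem monomial_add (g : G) (r s : R) :
    monomial c g (r + s) = monomial c g r + monomial c g s := Finsupp.single_add g r s

@[simp] theorem smul_monomial (r : R) (g : G) (s : R) :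
    r • monomial c g s = monomial c g (r * s) := Finsupp.smul_single r g s

theorem induction_on {p : CrossedProduct c → Prop} (x : CrossedProduct c) (h0 : p 0)
    (hadd : ∀ x y, p x → p y → p (x + y)) (hm : ∀ g r, p (monomial c g r)) : p x :=
  Finsupp.induction_linear (motive := p) x h0 hadd hm

protected theorem add_mul' (x y z : CrossedProduct c) : (x + y) * z = x * z + y * z := by
  refine Finsupp.sum_add_index' (f := x) (g := y) ?_ ?_
  · intro g; simp only [zero_mul, monomial_zero]; exact Finsupp.sum_fun_zero _
  · intro g r s
    simp only [add_mul, monomial_add]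
    exact Finsupp.sum_add

protected theorem mul_add' (x y z : CrossedProduct c) : x * (y + z) = x * y + x * z := by
  rw [mul_def, mul_def, mul_def]
  refine Eq.trans ?_ Finsupp.sum_add
  refine Finsupp.sum_congr fun g _ => ?_
  refine Finsupp.sum_add_index' (f := y) (g := z) ?_ ?_
  · intro h; simp
  · intro h r s; simp only [map_add, mul_add, add_mul, monomial_add]

protected theorem zero_mul' (x : CrossedProduct c) : 0 * x = 0 := Finsupp.sum_zero_index

protected theorem mul_zero' (x : CrossedProduct c) : x * 0 = 0 := Finsupp.sum_fun_zero _

/-- `(r g̲) (s h̲) = r σ_g(s) ρ(g,h) (gh)̲`. -/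
theorem monomial_mul_monomial (g h : G) (r s : R) :
    monomial c g r * monomial c h s = monomial c (g * h) (r * c.σ g s * (c.ρ g h : R)) := by
  rw [mul_def]
  refine (Finsupp.sum_single_index ?_).trans (Finsupp.sum_single_index ?_)
  · simp only [zero_mul, monomial_zero]; exact Finsupp.sum_fun_zero _
  · simp

protected theorem mul_assoc' (x y z : CrossedProduct c) : x * y * z = x * (y * z) := by
  induction x using induction_on with
  | h0 => simp only [CrossedProduct.zero_mul']
  | hadd a b ha hb => simp only [CrossedProduct.add_mul', ha, hb]
  | hm g r =>
    induction y using induction_on with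
    | h0 => simp only [CrossedProduct.zero_mul', CrossedProduct.mul_zero']
    | hadd a b ha hb => simp only [CrossedProduct.add_mul', CrossedProduct.mul_add', ha, hb]
    | hm h s =>
      induction z using induction_on with
      | h0 => simp only [CrossedProduct.mul_zero']
      | hadd a b ha hb => simp only [CrossedProduct.mul_add', ha, hb]
      | hm k t =>
        simp only [monomial_mul_monomial, mul_assoc]
        congr 1
        simp only [map_mul, mul_assoc, c.cross_two g h t, ← c.cross_one g h k]
        simp

protected theorem one_mul' (x : CrossedProduct c) : 1 * x = x := by
  induction x using induction_on with
  | h0 => exact CrossedProduct.mul_zero' _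
  | hadd a b ha hb => simp only [CrossedProduct.mul_add', ha, hb]
  | hm g r => simp [one_def, monomial_mul_monomial, c.σ_one, c.ρ_one_left]

protected theorem mul_one' (x : CrossedProduct c) : x * 1 = x := by
  induction x using induction_on with
  | h0 => exact CrossedProduct.zero_mul' _
  | hadd a b ha hb => simp only [CrossedProduct.add_mul', ha, hb]
  | hm g r => simp [one_def, monomial_mul_monomial, c.ρ_one_right]

noncomputable instance instRing : Ring (CrossedProduct c) :=
  { instAddCommGroup with
    left_distrib := CrossedProduct.mul_add'
    right_distrib := CrossedProduct.add_mul'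
    zero_mul := CrossedProduct.zero_mul'
    mul_zero := CrossedProduct.mul_zero'
    mul_assoc := CrossedProduct.mul_assoc'
    one_mul := CrossedProduct.one_mul'
    mul_one := CrossedProduct.mul_one' }

protected theorem smul_mul' (r : R) (x y : CrossedProduct c) : (r • x) * y = r • (x * y) := by
  induction x using induction_on with
  | h0 => simp
  | hadd a b ha hb => simp only [smul_add, add_mul, ha, hb]
  | hm g s =>
    induction y using induction_on with
    | h0 => simp
    | hadd a b ha hb => simp only [smul_add, mul_add, ha, hb]
    | hm h t => simp only [smul_monomial, monomial_mul_monomial, mul_assoc]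

instance : IsScalarTower R (CrossedProduct c) (CrossedProduct c) :=
  ⟨CrossedProduct.smul_mul'⟩

/-- `g̲ r = σ_g(r) g̲`. -/
theorem of_mul_smul_one (g : G) (r : R) :
    of c g * (r • (1 : CrossedProduct c)) = c.σ g r • of c g := by
  simp [of, one_def, monomial_mul_monomial, c.ρ_one_right]

/-- The canonical embedding `R → R * G`, `r ↦ r e̲`. Restricting scalars along it makes every
left `R * G`-module a left `R`-module. -/
noncomputable def incl (c : CrossedSystem R G) : R →+* CrossedProduct c where
  toFun r := monomial c 1 r
  map_one' := rfl
  map_mul' r s := by simp [monomial_mul_monomial, c.σ_one, c.ρ_one_left]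
  map_zero' := monomial_zero 1
  map_add' := monomial_add 1

theorem incl_eq_smul_one (r : R) : incl c r = r • (1 : CrossedProduct c) := by
  rw [one_def, smul_monomial, mul_one]; rfl

/-! ## Trajectories and entropy

A left `R * G`-module `M` is regarded as a left `R`-module by restriction of scalars along `incl`.
This is what the pair `[Module R M] [IsScalarTower R (CrossedProduct c) M]` expresses; see
`smul_eq_incl_smul` and `restrictScalars_isScalarTower`. -/

section Module

variable {M : Type w} [AddCommGroup M] [Module (CrossedProduct c) M]

/-- The `R`-module structure of an `R * G`-module is the restricted one, hence unique. -/
theorem smul_eq_incl_smul [Module R M] [IsScalarTower R (CrossedProduct c) M] (r : R) (m : M) :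
    r • m = incl c r • m := by
  rw [incl_eq_smul_one, smul_assoc, one_smul]

/-- Every `R * G`-module has such an `R`-module structure. -/
theorem restrictScalars_isScalarTower :
    letI : Module R M := Module.compHom M (incl c)
    IsScalarTower R (CrossedProduct c) M := by
  let _ : Module R M := Module.compHom M (incl c)
  refine ⟨fun r x m => ?_⟩
  have h : r • x = incl c r * x := by
    rw [incl_eq_smul_one, smul_mul_assoc, one_mul]
  rw [h, mul_smul]
  rfl

variable [Module R M] [IsScalarTower R (CrossedProduct c) M]

theorem of_smul_smul (g : G) (r : R) (m : M) :
    of c g • r • m = c.σ g r • of c g • m := by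
  rw [← smul_assoc (c.σ g r), ← of_mul_smul_one, mul_smul, smul_assoc, one_smul]

/-- The `R`-submodule `λ_g(V) = g̲ V` of `M`. -/
def translate (c : CrossedSystem R G) {M : Type w} [AddCommGroup M] [Module (CrossedProduct c) M]
    [Module R M] [IsScalarTower R (CrossedProduct c) M] (g : G) (V : Submodule R M) :
    Submodule R M where
  carrier := (fun m => of c g • m) '' (V : Set M)
  add_mem' := by
    rintro _ _ ⟨a, ha, rfl⟩ ⟨b, hb, rfl⟩
    exact ⟨a + b, V.add_mem ha hb, smul_add _ _ _⟩
  zero_mem' := ⟨0, V.zero_mem, smul_zero _⟩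
  smul_mem' := by
    rintro r _ ⟨a, ha, rfl⟩
    refine ⟨(c.σ g).symm r • a, V.smul_mem _ ha, ?_⟩
    simp only [of_smul_smul, RingEquiv.apply_symm_apply]

/-- The trajectory `T_F(λ, V) = ∑_{g ∈ F} g̲ V`. -/
def trajectory (c : CrossedSystem R G) {M : Type w} [AddCommGroup M] [Module (CrossedProduct c) M]
    [Module R M] [IsScalarTower R (CrossedProduct c) M] (F : Finset G) (V : Submodule R M) :
    Submodule R M :=
  ⨆ g ∈ F, translate c g V

end Module

section Entropy

variable {K : Type u} [DivisionRing K]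

/-- The ratio `dim_K T_F(λ, V) / |F|`. -/
noncomputable def dimRatio (c : CrossedSystem K G) {M : Type w} [AddCommGroup M]
    [Module (CrossedProduct c) M] [Module K M] [IsScalarTower K (CrossedProduct c) M]
    (V : Submodule K M) (F : Finset G) : ℝ≥0∞ :=
  (Module.finrank K (trajectory c F V) : ℝ≥0∞) / (F.card : ℝ≥0∞)

/-- The `dim`-entropy of `M` with respect to the finite dimensional subspace `V`: the limit of
`dim_K T_{F n}(λ, V) / |F n|`, computed along the Følner sequence `F`. -/
noncomputable def entWith (c : CrossedSystem K G) (F : ℕ → Finset G) {M : Type w} [AddCommGroup M]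
    [Module (CrossedProduct c) M] [Module K M] [IsScalarTower K (CrossedProduct c) M]
    (V : Submodule K M) : ℝ≥0∞ :=
  limUnder atTop fun n => dimRatio c V (F n)

/-- The algebraic `dim`-entropy of the left `K * G`-module `M`, computed along the Følner
sequence `F`: the supremum of `entWith` over the finite dimensional `K`-subspaces of `M`. -/
noncomputable def entDim (c : CrossedSystem K G) (F : ℕ → Finset G) (M : Type w) [AddCommGroup M]
    [Module (CrossedProduct c) M] [Module K M] [IsScalarTower K (CrossedProduct c) M] : ℝ≥0∞ :=
  ⨆ (V : Submodule K M) (_ : Module.Finite K V), entWith c F V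

/-- The set of values of the `dim`-entropy on left `K * G`-modules. -/
def entDimValues (c : CrossedSystem K G) (F : ℕ → Finset G) : Set ℝ≥0∞ :=
  {a | ∃ (M : Type (max u v)) (_ : AddCommGroup M) (_ : Module (CrossedProduct c) M)
    (_ : Module K M) (_ : IsScalarTower K (CrossedProduct c) M), entDim c F M = a}

end Entropy

end CrossedProduct

/-! ## Ore domains -/

/-- A domain `D` is left Ore if `D x ∩ D y ≠ 0` for all nonzero `x`, `y`. -/
def IsLeftOreDomain (D : Type*) [Ring D] : Prop :=
  IsDomain D ∧ ∀ x y : D, x ≠ 0 → y ≠ 0 → ∃ a b : D, a * x = b * y ∧ a * x ≠ 0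

/-- A domain `D` is right Ore if `x D ∩ y D ≠ 0` for all nonzero `x`, `y`. -/
def IsRightOreDomain (D : Type*) [Ring D] : Prop :=
  IsDomain D ∧ ∀ x y : D, x ≠ 0 → y ≠ 0 → ∃ a b : D, x * a = y * b ∧ x * a ≠ 0

/-- The set `ℕ ∪ {∞}` inside `[0, ∞]`. -/
def natOrTop : Set ℝ≥0∞ := Set.range (fun n : ℕ => (n : ℝ≥0∞)) ∪ {⊤}

/-! Everything is governed by one number, `meanDim`: the infimum of `dim T_F(V) / |F|` over nonempty
finite `F`. The function `F ↦ dim T_F(V)` is monotone, submodular and left invariant, so Shearer's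
inequality gives `|F| dim T_E(V) ≤ |E F⁻¹| dim T_F(V)`. Letting `E` run along a Følner sequence
shows that the ratios converge to the infimum (`tendsto_meanDim`), whichever sequence is used.

In a domain, a nonzero `x` has `dim T_A(Kx) = |A|`, and therefore adding a vector that is torsion
modulo the module generated by `V` leaves `meanDim` unchanged (`meanDim_sup_span_singleton_le`).
Hence `meanDim` is the size of a maximal independent subfamily of a basis of `V`, a natural number,
and nontrivial cyclic quotients have entropy zero.

Conversely, suppose `x * y = 0` with `x`, `y` nonzero and let `I` be the left annihilator of `y`.
The entropy of the quotient by `I` is at least `1 / |supp y|` and at most `1 - 1 / |supp x|`: it is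
neither zero nor an integer.

The left Ore condition holds because two independent elements would give the rank one free module
entropy at least 2. On the right, a direct dimension count over `Kᵐᵒᵖ` in an almost invariant set is
used. All values in `ℕ ∪ {∞}` are taken by free modules. -/

/-! ### Submodular set functions. -/

section Submodular

open scoped Pointwise

variable {G : Type*} [DecidableEq G]

/-- Shearer's inequality: if every point of `E` is covered by exactly `k` of the sets `A x`, then
a submodular set function `f` with `f ∅ = 0` satisfies `k f(E) ≤ ∑ f(E ∩ A x)`. -/
theorem nsmul_le_sum_of_submodular {f : Finset G → ℝ} (h0 : f ∅ = 0)
    (hf : ∀ A B, f (A ∪ B) + f (A ∩ B) ≤ f A + f B) {ι : Type*} (s : Finset ι)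
    (A : ι → Finset G) (k : ℕ) (E : Finset G)
    (hk : ∀ e ∈ E, (s.filter fun x => e ∈ A x).card = k) :
    (k : ℝ) * f E ≤ ∑ x ∈ s, f (E ∩ A x) := by
  induction E using Finset.induction_on with
  | empty => simp [h0]
  | insert e E he ih =>
    have ih := ih fun a ha => hk a (Finset.mem_insert_of_mem ha)
    -- Diminishing returns: adding `e` to the smaller set `E ∩ A x` gains at least as much as adding
    -- it to `E`, and this happens for exactly `k` indices.
    have key : ∀ x ∈ s, f (E ∩ A x) + (if e ∈ A x then f (insert e E) - f E else 0) ≤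
        f (insert e E ∩ A x) := by
      intro x _
      split_ifs with hx
      · have h := hf (insert e E ∩ A x) E
        have h1 : (insert e E ∩ A x) ∪ E = insert e E := by
          ext a; simp only [Finset.mem_union, Finset.mem_inter, Finset.mem_insert]
          constructor
          · tauto
          · rintro (rfl | h)
            · exact Or.inl ⟨Or.inl rfl, hx⟩
            · exact Or.inr h
        have h2 : (insert e E ∩ A x) ∩ E = E ∩ A x := by
          ext a; simp only [Finset.mem_inter, Finset.mem_insert]; tauto
        rw [h1, h2] at h
        linarith
      · rw [Finset.insert_inter_of_notMem hx, add_zero]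
    have hsum := Finset.sum_le_sum key
    rw [Finset.sum_add_distrib, ← Finset.sum_filter, Finset.sum_const, nsmul_eq_mul,
      hk e (Finset.mem_insert_self _ _)] at hsum
    linarith

variable [Group G]

/-- For a monotone submodular left invariant set function, the average over any finite set bounds
the average over a sufficiently right invariant set. -/
theorem card_mul_le_card_mul_of_submodular {f : Finset G → ℝ} (h0 : f ∅ = 0)
    (hf : ∀ A B, f (A ∪ B) + f (A ∩ B) ≤ f A + f B) (hmono : Monotone f)
    (hinv : ∀ (g : G) (A : Finset G), f (g • A) = f A) (E F : Finset G) :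
    (F.card : ℝ) * f E ≤ ((E * F⁻¹).card : ℝ) * f F := by
  -- The translates `x • F` containing `e` are those with `x = e * a⁻¹`, `a ∈ F`; they all occur in
  -- `E * F⁻¹`, so the covering multiplicity is `|F|`.
  refine (nsmul_le_sum_of_submodular h0 hf (E * F⁻¹) (fun x => x • F) F.card E ?_).trans ?_
  · intro e he
    refine (Finset.card_bij (fun a _ => e * a⁻¹) ?_ ?_ ?_).symm
    · intro a ha
      refine Finset.mem_filter.2 ⟨Finset.mul_mem_mul he (Finset.inv_mem_inv ha), ?_⟩
      exact Finset.mem_smul_finset.2 ⟨a, ha, by simp⟩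
    · intro a _ b _ h
      simpa using h
    · intro x hx
      obtain ⟨a, ha, h⟩ := Finset.mem_smul_finset.1 (Finset.mem_filter.1 hx).2
      exact ⟨a, ha, by rw [← h]; simp⟩
  · refine (Finset.sum_le_card_nsmul _ _ (f F) ?_).trans (by rw [nsmul_eq_mul])
    intro x _
    exact (hmono Finset.inter_subset_right).trans_eq (hinv x F)

end Submodular

/-! ### Følner sequences and almost invariant sets. -/

section Folner

open scoped Pointwise

theorem Group.FG.countable (G : Type*) [Group G] [Group.FG G] : Countable G := by
  obtain ⟨α, _, φ, hφ⟩ := Group.fg_iff_exists_freeGroup_hom_surjective_finite.1 ‹Group.FG G›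
  have : Countable (FreeGroup α) := by
    unfold FreeGroup; infer_instance
  exact hφ.countable


variable {G : Type v} [Group G]

theorem cBoundary_mono {C C' : Finset G} (h : C ⊆ C') (A : Finset G) :
    cBoundary C A ⊆ cBoundary C' A := by
  rintro x ⟨⟨c, hc, hx⟩, hi⟩
  exact ⟨⟨c, h hc, hx⟩, fun hi' => hi fun c hc => hi' c (h hc)⟩

/-- A countable amenable group has a Følner sequence. -/
theorem IsAmenableGroup.exists_seq [Countable G] (hG : IsAmenableGroup G) :
    ∃ F : ℕ → Finset G, IsFolnerNet F := by
  classical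
  obtain ⟨I, _, _, _, F, hF⟩ := hG
  obtain ⟨e, he⟩ := exists_surjective_nat G
  let C : ℕ → Finset G := fun n => (Finset.range n).image e
  have hC : ∀ D : Finset G, ∃ N, ∀ n ≥ N, D ⊆ C n := by
    intro D
    choose k hk using he
    refine ⟨D.sup (fun g => k g + 1), fun n hn g hg => Finset.mem_image.2 ⟨k g, ?_, hk g⟩⟩
    have := Finset.le_sup (f := fun g => k g + 1) hg
    exact Finset.mem_range.2 (by omega)
  -- Diagonal choice along the exhaustion `C n`: a fixed `D` lies in `C n` for large `n`, so its
  -- boundary ratio is eventually below `1 / (n + 1)`.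
  have h : ∀ n : ℕ, ∃ i, ((cBoundary (C n) (F i)).ncard : ℝ) / ((F i).card : ℝ) < 1 / (n + 1) :=
    fun n => ((hF.tendsto_boundary (C n)).eventually_lt_const
      (by positivity : (0 : ℝ) < 1 / (n + 1))).exists
  choose i hi using h
  refine ⟨fun n => F (i n), fun n => hF.nonempty _, fun D => ?_⟩
  obtain ⟨N, hN⟩ := hC D
  refine tendsto_of_tendsto_of_tendsto_of_le_of_le' tendsto_const_nhds
    tendsto_one_div_add_atTop_nhds_zero_nat (Eventually.of_forall fun n => by positivity) ?_
  filter_upwards [eventually_ge_atTop N] with n hn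
  refine le_trans ?_ (hi n).le
  gcongr
  exacts [cBoundary_finite _ _, cBoundary_mono (hN n hn) _]

variable [DecidableEq G]

/-- Every point of `A * S` is in the `S⁻¹`-exterior of `A`. If it is also interior, it lies in the
single translate `A s` of a fixed `s ∈ S`; otherwise it is a boundary point. -/
theorem card_mul_le_card_add_ncard_cBoundary (A : Finset G) {S : Finset G} (hS : S.Nonempty) :
    (A * S).card ≤ A.card + (cBoundary S⁻¹ A).ncard := by
  obtain ⟨s, hs⟩ := hS
  have h1 : ((A * S : Finset G) : Set G) ⊆ ((A.image fun a => a * s : Finset G) : Set G) ∪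
      cBoundary S⁻¹ A := by
    intro x hx
    obtain ⟨a, ha, t, ht, rfl⟩ := Finset.mem_mul.1 (Finset.mem_coe.1 hx)
    by_cases hi : a * t ∈ cInterior S⁻¹ A
    · left
      exact Finset.mem_coe.2 (Finset.mem_image.2
        ⟨a * t * s⁻¹, hi _ (Finset.inv_mem_inv hs), by simp⟩)
    · exact Or.inr ⟨⟨t⁻¹, Finset.inv_mem_inv ht, by simpa using ha⟩, hi⟩
  have h2 := Set.ncard_le_ncard h1 ((Finset.finite_toSet _).union (cBoundary_finite _ _))
  rw [Set.ncard_coe_finset] at h2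
  refine h2.trans ((Set.ncard_union_le _ _).trans ?_)
  rw [Set.ncard_coe_finset]
  exact Nat.add_le_add_right Finset.card_image_le _

/-- The elements `x` of `A` with `x S ⊆ A`. -/
def core (S A : Finset G) : Finset G := A.filter fun x => ∀ s ∈ S, x * s ∈ A

theorem core_subset (S A : Finset G) : core S A ⊆ A := Finset.filter_subset _ _

theorem core_mul_subset (S A : Finset G) : core S A * S ⊆ A := by
  intro x hx
  obtain ⟨a, ha, s, hs, rfl⟩ := Finset.mem_mul.1 hx
  exact (Finset.mem_filter.1 ha).2 s hs

/-- Adjoining `1` puts all of `A` into the exterior, so a point of `A` off the boundary is interior.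
-/
theorem card_le_card_core_add_ncard_cBoundary (S A : Finset G) :
    A.card ≤ (core S A).card + (cBoundary (insert 1 S) A).ncard := by
  have h1 : (A : Set G) ⊆ (core S A : Set G) ∪ cBoundary (insert 1 S) A := by
    intro x hx
    by_cases hi : x ∈ cInterior (insert 1 S) A
    · exact Or.inl (Finset.mem_coe.2 (Finset.mem_filter.2
        ⟨hx, fun s hs => hi s (Finset.mem_insert_of_mem hs)⟩))
    · exact Or.inr ⟨⟨1, Finset.mem_insert_self _ _, by simpa using hx⟩, hi⟩
  have h2 := Set.ncard_le_ncard h1 ((Finset.finite_toSet _).union (cBoundary_finite _ _))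
  rw [Set.ncard_coe_finset] at h2
  refine h2.trans ((Set.ncard_union_le _ _).trans ?_)
  rw [Set.ncard_coe_finset]

namespace IsFolnerNet

variable {I : Type*} [Preorder I] {F : I → Finset G}

omit [DecidableEq G] in
theorem card_pos (hF : IsFolnerNet F) (i : I) : (0 : ℝ) < (F i).card :=
  Nat.cast_pos.2 (hF.nonempty i).card_pos

theorem tendsto_card_mul (hF : IsFolnerNet F) {S : Finset G} (hS : S.Nonempty) :
    Tendsto (fun i => ((F i * S).card : ℝ) / (F i).card) atTop (𝓝 1) := by
  have h := (hF.tendsto_boundary S⁻¹).const_add 1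
  rw [add_zero] at h
  refine tendsto_of_tendsto_of_tendsto_of_le_of_le tendsto_const_nhds h ?_ ?_
  · intro i
    simp only
    rw [one_le_div (hF.card_pos i)]
    exact_mod_cast Finset.card_le_card_mul_right hS
  · intro i
    simp only
    rw [div_le_iff₀ (hF.card_pos i), add_mul, div_mul_cancel₀ _ (hF.card_pos i).ne', one_mul]
    exact_mod_cast card_mul_le_card_add_ncard_cBoundary (F i) hS

theorem tendsto_card_core (hF : IsFolnerNet F) (S : Finset G) :
    Tendsto (fun i => ((core S (F i)).card : ℝ) / (F i).card) atTop (𝓝 1) := by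
  have h := (hF.tendsto_boundary (insert 1 S)).const_sub 1
  rw [sub_zero] at h
  refine tendsto_of_tendsto_of_tendsto_of_le_of_le h tendsto_const_nhds ?_ ?_
  · intro i
    simp only
    rw [le_div_iff₀ (hF.card_pos i), sub_mul, div_mul_cancel₀ _ (hF.card_pos i).ne', one_mul,
      sub_le_iff_le_add]
    exact_mod_cast card_le_card_core_add_ncard_cBoundary S (F i)
  · intro i
    simp only
    rw [div_le_one (hF.card_pos i)]
    exact_mod_cast Finset.card_le_card (core_subset S (F i))

end IsFolnerNet

end Folner

/-! ### A dimension estimate for sums with an image. -/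

section LinearAlgebra

variable {K : Type*} [DivisionRing K] {D M : Type*} [AddCommGroup D] [Module K D]
  [AddCommGroup M] [Module K M]

/-- The image of `Q` is absorbed by `B`, so only a complement of `Q` in `P` can contribute new
dimensions. -/
theorem finrank_sup_map_add_finrank_le (φ : D →ₗ[K] M) {P Q : Submodule K D}
    [Module.Finite K P] (hQP : Q ≤ P) {B : Submodule K M} [Module.Finite K B]
    (hQB : Q.map φ ≤ B) :
    Module.finrank K (B ⊔ P.map φ : Submodule K M) + Module.finrank K Q ≤
      Module.finrank K B + Module.finrank K P := by
  obtain ⟨C, hC⟩ := Q.exists_isCompl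
  have hQ : Module.Finite K Q := Submodule.finiteDimensional_of_le hQP
  have hCP : Module.Finite K (C ⊓ P : Submodule K D) :=
    Submodule.finiteDimensional_of_le inf_le_right
  have h1 : Q ⊔ C ⊓ P = P := by
    rw [← sup_inf_assoc_of_le C hQP, hC.sup_eq_top, top_inf_eq]
  have h2 := Submodule.finrank_sup_add_finrank_inf_eq Q (C ⊓ P)
  rw [h1, ← inf_assoc, hC.inf_eq_bot, bot_inf_eq, finrank_bot] at h2
  have h3 : B ⊔ P.map φ = B ⊔ (C ⊓ P).map φ := by
    conv_lhs => rw [← h1, Submodule.map_sup, ← sup_assoc, sup_eq_left.2 hQB]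
  rw [h3]
  have h4 := Submodule.finrank_add_le_finrank_add_finrank B ((C ⊓ P).map φ)
  have h5 := Submodule.finrank_map_le φ (C ⊓ P)
  omega

end LinearAlgebra

/-! ### Algebra of trajectories. -/

namespace CrossedProduct

open scoped Pointwise

section Trajectory

variable {R : Type u} [Ring R] {G : Type v} [Group G] {c : CrossedSystem R G}
  {M : Type w} [AddCommGroup M] [Module (CrossedProduct c) M]
  [Module R M] [IsScalarTower R (CrossedProduct c) M]

theorem of_mul_of (g h : G) : of c g * of c h = (c.ρ g h : R) • of c (g * h) := by
  simp [of, monomial_mul_monomial]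

theorem of_smul_of_smul (g h : G) (m : M) :
    of c g • of c h • m = (c.ρ g h : R) • of c (g * h) • m := by
  rw [← mul_smul, of_mul_of, smul_assoc]

/-- The preimage of `W` under the action of `g̲`. -/
def comapOf (c : CrossedSystem R G) {M : Type w} [AddCommGroup M] [Module (CrossedProduct c) M]
    [Module R M] [IsScalarTower R (CrossedProduct c) M] (g : G) (W : Submodule R M) :
    Submodule R M where
  carrier := {m | of c g • m ∈ W}
  add_mem' ha hb := by
    simp only [Set.mem_ofPred_eq, smul_add] at *
    exact W.add_mem ha hb
  zero_mem' := by simp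
  smul_mem' r m hm := by
    simp only [Set.mem_ofPred_eq, of_smul_smul] at *
    exact W.smul_mem _ hm

theorem mem_comapOf {g : G} {W : Submodule R M} {m : M} :
    m ∈ comapOf c g W ↔ of c g • m ∈ W := Iff.rfl

/-- Adjunction form: the condition on `V` is containment in submodules, so it can be tested on
generators or summands of `V`. -/
theorem trajectory_le_iff_le_comapOf {F : Finset G} {V W : Submodule R M} :
    trajectory c F V ≤ W ↔ ∀ g ∈ F, V ≤ comapOf c g W := by
  simp only [trajectory, iSup_le_iff]
  refine forall₂_congr fun g _ => ⟨fun h v hv => h ⟨v, hv, rfl⟩, ?_⟩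
  rintro h _ ⟨v, hv, rfl⟩
  exact h hv

theorem trajectory_le_iff {F : Finset G} {V W : Submodule R M} :
    trajectory c F V ≤ W ↔ ∀ g ∈ F, ∀ v ∈ V, of c g • v ∈ W :=
  trajectory_le_iff_le_comapOf

theorem trajectory_span_le_iff {F : Finset G} {s : Set M} {W : Submodule R M} :
    trajectory c F (Submodule.span R s) ≤ W ↔ ∀ g ∈ F, ∀ v ∈ s, of c g • v ∈ W := by
  simp only [trajectory_le_iff_le_comapOf, Submodule.span_le]
  rfl

theorem of_smul_mem_trajectory {F : Finset G} {V : Submodule R M} {g : G} (hg : g ∈ F) {v : M}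
    (hv : v ∈ V) : of c g • v ∈ trajectory c F V :=
  trajectory_le_iff.1 le_rfl g hg v hv

theorem of_smul_mem_trajectory_span {F : Finset G} {s : Set M} {g : G} (hg : g ∈ F) {v : M}
    (hv : v ∈ s) : of c g • v ∈ trajectory c F (Submodule.span R s) :=
  of_smul_mem_trajectory hg (Submodule.subset_span hv)

theorem trajectory_mono {F F' : Finset G} (hF : F ⊆ F') {V V' : Submodule R M} (hV : V ≤ V') :
    trajectory c F V ≤ trajectory c F' V' :=
  trajectory_le_iff.2 fun _ hg _ hv => of_smul_mem_trajectory (hF hg) (hV hv)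

theorem trajectory_empty (V : Submodule R M) : trajectory c ∅ V = ⊥ := by
  simp [trajectory]

theorem trajectory_union [DecidableEq G] (A B : Finset G) (V : Submodule R M) :
    trajectory c (A ∪ B) V = trajectory c A V ⊔ trajectory c B V := by
  refine le_antisymm (trajectory_le_iff.2 fun g hg v hv => ?_)
    (sup_le (trajectory_mono Finset.subset_union_left le_rfl)
      (trajectory_mono Finset.subset_union_right le_rfl))
  rcases Finset.mem_union.1 hg with h | h
  · exact Submodule.mem_sup_left (of_smul_mem_trajectory h hv)
  · exact Submodule.mem_sup_right (of_smul_mem_trajectory h hv)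

theorem trajectory_sup (F : Finset G) (V W : Submodule R M) :
    trajectory c F (V ⊔ W) = trajectory c F V ⊔ trajectory c F W := by
  refine le_antisymm (trajectory_le_iff_le_comapOf.2 fun g hg => sup_le ?_ ?_)
    (sup_le (trajectory_mono subset_rfl le_sup_left) (trajectory_mono subset_rfl le_sup_right))
  · exact fun v hv => Submodule.mem_sup_left (of_smul_mem_trajectory hg hv)
  · exact fun v hv => Submodule.mem_sup_right (of_smul_mem_trajectory hg hv)

theorem trajectory_trajectory [DecidableEq G] (A B : Finset G) (V : Submodule R M) :
    trajectory c A (trajectory c B V) = trajectory c (A * B) V := by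
  refine le_antisymm (trajectory_le_iff_le_comapOf.2 fun g hg => trajectory_le_iff.2 ?_)
    (trajectory_le_iff.2 ?_)
  · intro h hh v hv
    rw [mem_comapOf, of_smul_of_smul]
    exact Submodule.smul_mem _ _ (of_smul_mem_trajectory (Finset.mul_mem_mul hg hh) hv)
  · intro k hk v hv
    obtain ⟨g, hg, h, hh, rfl⟩ := Finset.mem_mul.1 hk
    have : of c (g * h) • v = ((c.ρ g h)⁻¹ : Rˣ) • of c g • of c h • v := by
      rw [of_smul_of_smul, ← Units.smul_def, inv_smul_smul]
    rw [this]
    exact Submodule.smul_mem _ _ (of_smul_mem_trajectory hg (of_smul_mem_trajectory hh hv))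

theorem trajectory_span_range {ι : Type*} (F : Finset G) (b : ι → M) :
    trajectory c F (Submodule.span R (Set.range b)) =
      Submodule.span R (Set.range fun p : F × ι => of c (p.1 : G) • b p.2) := by
  refine le_antisymm (trajectory_span_le_iff.2 ?_) (Submodule.span_le.2 ?_)
  · rintro g hg _ ⟨i, rfl⟩
    exact Submodule.subset_span ⟨(⟨g, hg⟩, i), rfl⟩
  · rintro _ ⟨⟨g, i⟩, rfl⟩
    exact of_smul_mem_trajectory_span g.2 ⟨i, rfl⟩

theorem map_trajectory {N : Type*} [AddCommGroup N] [Module (CrossedProduct c) N]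
    [Module R N] [IsScalarTower R (CrossedProduct c) N] (f : M →ₗ[CrossedProduct c] N)
    (F : Finset G) (V : Submodule R M) :
    (trajectory c F V).map (f.restrictScalars R) = trajectory c F (V.map (f.restrictScalars R)) := by
  refine le_antisymm (Submodule.map_le_iff_le_comap.2 (trajectory_le_iff.2 ?_))
    (trajectory_le_iff.2 ?_)
  · intro g hg v hv
    simp only [Submodule.mem_comap, LinearMap.coe_restrictScalars, map_smul]
    exact of_smul_mem_trajectory hg ⟨v, hv, rfl⟩
  · rintro g hg _ ⟨v, hv, rfl⟩
    exact ⟨of c g • v, of_smul_mem_trajectory hg hv, by simp⟩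

/-- The support of an element of the crossed product. -/
noncomputable def supp (x : CrossedProduct c) : Finset G := Finsupp.support (x : G →₀ R)

theorem supp_nonempty {x : CrossedProduct c} (hx : x ≠ 0) : (supp x).Nonempty :=
  Finsupp.support_nonempty_iff.2 hx

/-- The coefficient of `g̲`. -/
def coeff (x : CrossedProduct c) (g : G) : R :=
  DFunLike.coe (F := G →₀ R) x g

theorem mem_supp {x : CrossedProduct c} {g : G} : g ∈ supp x ↔ coeff x g ≠ 0 :=
  Finsupp.mem_support_iff

theorem sum_coeff_smul_of (x : CrossedProduct c) :
    ∑ g ∈ supp x, coeff x g • of c g = x := by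
  simp only [of, smul_monomial, mul_one]
  exact Finsupp.sum_single (x : G →₀ R)

theorem smul_mem_trajectory (x : CrossedProduct c) {V : Submodule R M} {v : M} (hv : v ∈ V) :
    x • v ∈ trajectory c (supp x) V := by
  have : x • v = ∑ g ∈ supp x, coeff x g • of c g • v := by
    conv_lhs => rw [← sum_coeff_smul_of x]
    rw [Finset.sum_smul]
    exact Finset.sum_congr rfl fun g _ => smul_assoc _ _ _
  rw [this]
  exact Submodule.sum_mem _ fun g hg => Submodule.smul_mem _ _ (of_smul_mem_trajectory hg hv)

theorem exists_mem_trajectory {V : Submodule R M} {y : M}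
    (hy : y ∈ Submodule.span (CrossedProduct c) (V : Set M)) :
    ∃ S : Finset G, y ∈ trajectory c S V := by
  classical
  induction hy using Submodule.span_induction with
  | mem v hv => exact ⟨_, by simpa using smul_mem_trajectory (1 : CrossedProduct c) hv⟩
  | zero => exact ⟨∅, Submodule.zero_mem _⟩
  | add a b _ _ ha hb =>
    obtain ⟨S, hS⟩ := ha
    obtain ⟨T, hT⟩ := hb
    exact ⟨S ∪ T, Submodule.add_mem _ (trajectory_mono Finset.subset_union_left le_rfl hS)
      (trajectory_mono Finset.subset_union_right le_rfl hT)⟩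
  | smul x a _ ha =>
    obtain ⟨S, hS⟩ := ha
    exact ⟨supp x * S, by rw [← trajectory_trajectory]; exact smul_mem_trajectory x hS⟩

/-- A finite dimensional subspace of the module generated by `V` lies in a trajectory of `V`. -/
theorem exists_le_trajectory {V W : Submodule R M} (hW : W.FG)
    (h : (W : Set M) ⊆ Submodule.span (CrossedProduct c) (V : Set M)) :
    ∃ S : Finset G, W ≤ trajectory c S V := by
  classical
  obtain ⟨t, rfl⟩ := hW
  choose S hS using fun y : t => exists_mem_trajectory (h (Submodule.subset_span y.2))
  refine ⟨Finset.univ.biUnion S, Submodule.span_le.2 ?_⟩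
  intro y hy
  exact trajectory_mono (Finset.subset_biUnion_of_mem S (Finset.mem_univ _)) le_rfl (hS ⟨y, hy⟩)

/-- As `σ_g` is bijective and `ρ` takes unit values, the support of `g̲ x` is the `g`-translate of
that of `x`. -/
theorem coeff_of_mul (g k : G) (x : CrossedProduct c) :
    coeff (of c g * x) k = c.σ g (coeff x (g⁻¹ * k)) * (c.ρ g (g⁻¹ * k) : R) := by
  classical
  have hadd : ∀ (a b : CrossedProduct c) (l : G), coeff (a + b) l = coeff a l + coeff b l :=
    fun a b l => Finsupp.add_apply (a : G →₀ R) b l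
  have hmon : ∀ (a l : G) (r : R), coeff (monomial c a r) l = if a = l then r else 0 :=
    fun a l r => Finsupp.single_apply
  induction x using induction_on with
  | h0 =>
    have h0 : ∀ l, coeff (0 : CrossedProduct c) l = 0 := fun l => rfl
    simp [h0]
  | hadd a b ha hb => simp only [mul_add, hadd, ha, hb, map_add, add_mul]
  | hm h r =>
    simp only [of, monomial_mul_monomial, hmon, one_mul]
    by_cases hk : g * h = k
    · subst hk; simp
    · rw [if_neg hk, if_neg (by rintro rfl; simp at hk)]; simp

theorem linearIndependent_of : LinearIndependent R (of c) :=
  Finsupp.linearIndependent_single_one R G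

end Trajectory

/-! ### Dimensions of trajectories over a division ring. -/

section DivisionRing

variable {K : Type u} [DivisionRing K] {G : Type v} [Group G] {c : CrossedSystem K G}
  {M : Type w} [AddCommGroup M] [Module (CrossedProduct c) M]
  [Module K M] [IsScalarTower K (CrossedProduct c) M]

instance instNontrivial : Nontrivial (CrossedProduct c) :=
  inferInstanceAs (Nontrivial (G →₀ K))

theorem exists_fin_span_eq (V : Submodule K M) [Module.Finite K V] :
    ∃ (n : ℕ) (b : Fin n → M), n = Module.finrank K V ∧ Submodule.span K (Set.range b) = V := by
  let b := Module.finBasis K V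
  refine ⟨_, fun i => b i, rfl, ?_⟩
  have : (Set.range fun i => (b i : M)) = V.subtype '' Set.range b := by
    rw [← Set.range_comp]; rfl
  rw [this, ← Submodule.map_span, b.span_eq, Submodule.map_top, Submodule.range_subtype]

instance finite_trajectory (F : Finset G) (V : Submodule K M) [Module.Finite K V] :
    Module.Finite K (trajectory c F V) := by
  obtain ⟨n, b, -, rfl⟩ := exists_fin_span_eq V
  rw [trajectory_span_range]
  exact FiniteDimensional.span_of_finite K (Set.finite_range _)

theorem finrank_trajectory_span_range_le {ι : Type*} [Fintype ι] (F : Finset G) (b : ι → M) :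
    Module.finrank K (trajectory c F (Submodule.span K (Set.range b))) ≤
      F.card * Fintype.card ι := by
  rw [trajectory_span_range]
  refine (finrank_range_le_card (R := K) fun p : F × ι => of c (p.1 : G) • b p.2).trans_eq ?_
  simp

theorem finrank_trajectory_le (F : Finset G) (V : Submodule K M) [Module.Finite K V] :
    Module.finrank K (trajectory c F V) ≤ F.card * Module.finrank K V := by
  obtain ⟨n, b, hn, hb⟩ := exists_fin_span_eq V
  have := finrank_trajectory_span_range_le (c := c) F b
  rwa [hb, Fintype.card_fin, hn] at this

theorem finrank_trajectory_smul_le [DecidableEq G] (g : G) (F : Finset G) (V : Submodule K M)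
    [Module.Finite K V] :
    Module.finrank K (trajectory c (g • F) V) ≤ Module.finrank K (trajectory c F V) := by
  have := finrank_trajectory_le (c := c) {g} (trajectory c F V)
  rwa [trajectory_trajectory, Finset.singleton_mul, Finset.card_singleton, one_mul] at this

theorem finrank_trajectory_smul [DecidableEq G] (g : G) (F : Finset G) (V : Submodule K M)
    [Module.Finite K V] :
    Module.finrank K (trajectory c (g • F) V) = Module.finrank K (trajectory c F V) := by
  refine le_antisymm (finrank_trajectory_smul_le g F V) ?_
  have := finrank_trajectory_smul_le (c := c) g⁻¹ (g • F) V
  rwa [inv_smul_smul] at this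

/-- Submodularity: the union gives the sum of the two trajectories, while the intersection gives
only a subspace of their intersection. -/
theorem finrank_trajectory_union_add_inter_le [DecidableEq G] (A B : Finset G)
    (V : Submodule K M) [Module.Finite K V] :
    Module.finrank K (trajectory c (A ∪ B) V) + Module.finrank K (trajectory c (A ∩ B) V) ≤
      Module.finrank K (trajectory c A V) + Module.finrank K (trajectory c B V) := by
  rw [trajectory_union,
    ← Submodule.finrank_sup_add_finrank_inf_eq (trajectory c A V) (trajectory c B V)]
  refine Nat.add_le_add_left (Submodule.finrank_mono (le_inf ?_ ?_)) _
  · exact trajectory_mono Finset.inter_subset_left le_rfl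
  · exact trajectory_mono Finset.inter_subset_right le_rfl

/-- Linearly independent elements generate trajectories of the maximal possible dimension. -/
theorem finrank_trajectory_span_range {ι : Type*} [Fintype ι] {b : ι → M}
    (hb : LinearIndependent (CrossedProduct c) b) (F : Finset G) :
    Module.finrank K (trajectory c F (Submodule.span K (Set.range b))) =
      F.card * Fintype.card ι := by
  have h := linearIndependent_smul
    ((linearIndependent_of (c := c)).comp (Subtype.val : F → G) Subtype.val_injective) hb
  rw [trajectory_span_range]
  exact (finrank_span_eq_card h).trans (by simp)

theorem finrank_trajectory_span_singleton {v : M}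
    (hv : ∀ x : CrossedProduct c, x • v = 0 → x = 0) (F : Finset G) :
    Module.finrank K (trajectory c F (Submodule.span K {v})) = F.card := by
  have h : LinearIndependent (CrossedProduct c) fun _ : Unit => v :=
    Fintype.linearIndependent_iff.2 fun g hg i => hv _ (by simpa using hg)
  have := finrank_trajectory_span_range h F
  rwa [Set.range_const, Fintype.card_unit, mul_one] at this

/-- The dimension of a trajectory of a nonzero element grows linearly. -/
theorem card_le_card_supp_mul_finrank {x : CrossedProduct c} (hx : x ≠ 0) (F : Finset G) :
    F.card ≤ (supp x).card * Module.finrank K (trajectory c F (Submodule.span K {x})) := by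
  classical
  obtain ⟨s, hs⟩ := supp_nonempty hx
  let t : Set (CrossedProduct c) := (fun g => of c g * x) '' F
  have ht : trajectory c F (Submodule.span K {x}) = Submodule.span K t := by
    refine le_antisymm (trajectory_span_le_iff.2 ?_) (Submodule.span_le.2 ?_)
    · rintro g hg _ rfl
      exact Submodule.subset_span ⟨g, hg, rfl⟩
    · rintro _ ⟨g, hg, rfl⟩
      exact of_smul_mem_trajectory_span hg rfl
  -- A basis `b` is chosen among the translates `g̲ x`. The supports of its members, each of size at
  -- most `|supp x|`, cover the supports of all translates, hence all of `F s`.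
  obtain ⟨b, hbt, hspan, hb⟩ := exists_linearIndependent K t
  have hfin : b.Finite := (F.finite_toSet.image _).subset hbt
  lift b to Finset (CrossedProduct c) using hfin
  have hcard : Module.finrank K (Submodule.span K t) = b.card := by
    rw [← hspan, ← Fintype.card_coe]
    have := finrank_span_eq_card hb
    rw [Subtype.range_coe_subtype] at this
    exact this
  have hcoeff : ∀ g k, coeff (of c g * x) k ≠ 0 ↔ coeff x (g⁻¹ * k) ≠ 0 := by
    intro g k
    rw [coeff_of_mul]
    simp
  have hsupp : ∀ y ∈ b, (supp y).card ≤ (supp x).card := by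
    intro y hy
    obtain ⟨g, -, rfl⟩ := hbt hy
    refine Finset.card_le_card_of_injOn (fun k => g⁻¹ * k) ?_ (fun _ _ _ _ h => by simpa using h)
    intro k hk
    exact mem_supp.2 ((hcoeff g k).1 (mem_supp.1 hk))
  have hsub : F.image (fun g => g * s) ⊆ b.biUnion supp := by
    have hle : Submodule.span K t ≤
        (Finsupp.supported K K ((b.biUnion supp : Finset G) : Set G) :
          Submodule K (CrossedProduct c)) := by
      rw [← hspan]
      refine Submodule.span_le.2 fun y hy => (Finsupp.mem_supported K _).2 ?_
      exact_mod_cast Finset.subset_biUnion_of_mem supp hy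
    intro k hk
    obtain ⟨g, hg, rfl⟩ := Finset.mem_image.1 hk
    have h1 := (Finsupp.mem_supported K _).1 (hle (Submodule.subset_span ⟨g, hg, rfl⟩))
    refine Finset.mem_coe.1 (h1 (Finset.mem_coe.2 (mem_supp.2 ((hcoeff g _).2 ?_))))
    rw [inv_mul_cancel_left]
    exact mem_supp.1 hs
  calc F.card = (F.image fun g => g * s).card :=
        (Finset.card_image_of_injective _ (mul_left_injective s)).symm
    _ ≤ (b.biUnion supp).card := Finset.card_le_card hsub
    _ ≤ b.card * (supp x).card := Finset.card_biUnion_le_card_mul _ _ _ hsupp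
    _ = _ := by rw [ht, hcard, mul_comm]

/-- If `x • w` lies in a subspace containing its trajectory over `A`, adding the trajectory of `w`
over `E ⊇ A * supp x` increases the dimension by at most `|E|` minus the dimension of the
trajectory of `x` over `A`. -/
theorem finrank_sup_trajectory_add_finrank_le [DecidableEq G] {x : CrossedProduct c} {w : M}
    {A E : Finset G} (hE : A * supp x ⊆ E) {B : Submodule K M} [Module.Finite K B]
    (hB : trajectory c A (Submodule.span K {x • w}) ≤ B) :
    Module.finrank K (B ⊔ trajectory c E (Submodule.span K {w}) : Submodule K M) +
        Module.finrank K (trajectory c A (Submodule.span K {x})) ≤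
      Module.finrank K B + E.card := by
  -- Apply the linear estimate to `y ↦ y • w`, with `P` the trajectory of `1` over `E`, of dimension
  -- `|E|`, and `Q` the trajectory of `x` over `A`.
  let φ := LinearMap.toSpanSingleton (CrossedProduct c) M w
  have hφ : ∀ (F : Finset G) (y : CrossedProduct c),
      (trajectory c F (Submodule.span K {y})).map (φ.restrictScalars K) =
        trajectory c F (Submodule.span K {y • w}) := by
    intro F y
    rw [map_trajectory, Submodule.map_span, Set.image_singleton]
    rfl
  have h1 := hφ E 1
  rw [one_smul] at h1
  have hQP : trajectory c A (Submodule.span K {x}) ≤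
      trajectory c E (Submodule.span K {(1 : CrossedProduct c)}) := by
    refine le_trans ?_ (trajectory_mono hE le_rfl)
    rw [← trajectory_trajectory]
    refine trajectory_mono subset_rfl ?_
    rw [Submodule.span_singleton_le_iff_mem]
    simpa using smul_mem_trajectory x
      (Submodule.mem_span_singleton_self (R := K) (1 : CrossedProduct c))
  have := finrank_sup_map_add_finrank_le (φ.restrictScalars K) hQP
    ((hφ A x).trans_le hB)
  rwa [h1, finrank_trajectory_span_singleton (c := c) (v := (1 : CrossedProduct c))
    (fun y hy => by simpa using hy)] at this

end DivisionRing

end CrossedProduct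

/-! ### Mean dimension. -/

namespace CrossedProduct

open scoped Pointwise

section MeanDim

variable {K : Type u} [DivisionRing K] {G : Type v} [Group G] {c : CrossedSystem K G}
  {M : Type w} [AddCommGroup M] [Module (CrossedProduct c) M]
  [Module K M] [IsScalarTower K (CrossedProduct c) M]

/-- The infimum of the ratios `dim_K T_F(V) / |F|` over the nonempty finite sets `F`. Along every
Følner net this is the limit of these ratios. -/
noncomputable def meanDim (c : CrossedSystem K G) {M : Type w} [AddCommGroup M]
    [Module (CrossedProduct c) M] [Module K M] [IsScalarTower K (CrossedProduct c) M]
    (V : Submodule K M) : ℝ :=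
  ⨅ F : {F : Finset G // F.Nonempty},
    (Module.finrank K (trajectory c F.1 V) : ℝ) / (F.1.card : ℝ)

theorem meanDim_le (V : Submodule K M) {F : Finset G} (hF : F.Nonempty) :
    meanDim c V ≤ (Module.finrank K (trajectory c F V) : ℝ) / (F.card : ℝ) :=
  ciInf_le (f := fun F : {F : Finset G // F.Nonempty} =>
    (Module.finrank K (trajectory c F.1 V) : ℝ) / (F.1.card : ℝ))
    ⟨0, by rintro _ ⟨F, rfl⟩; positivity⟩ ⟨F, hF⟩

theorem le_meanDim {V : Submodule K M} {a : ℝ}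
    (h : ∀ F : Finset G, F.Nonempty → a * F.card ≤ Module.finrank K (trajectory c F V)) :
    a ≤ meanDim c V := by
  have : Nonempty {F : Finset G // F.Nonempty} := ⟨⟨{1}, Finset.singleton_nonempty 1⟩⟩
  refine le_ciInf fun F => ?_
  rw [le_div_iff₀ (Nat.cast_pos.2 F.2.card_pos)]
  exact h F.1 F.2

theorem meanDim_mono {V W : Submodule K M} [Module.Finite K W] (h : V ≤ W) :
    meanDim c V ≤ meanDim c W := by
  refine le_meanDim fun F hF => ?_
  have hpos : (0 : ℝ) < F.card := Nat.cast_pos.2 hF.card_pos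
  calc meanDim c V * F.card ≤ Module.finrank K (trajectory c F V) := by
        rw [← le_div_iff₀ hpos]; exact meanDim_le V hF
    _ ≤ _ := by exact_mod_cast Submodule.finrank_mono (trajectory_mono subset_rfl h)

theorem card_mul_finrank_trajectory_le [DecidableEq G] (V : Submodule K M) [Module.Finite K V]
    (E F : Finset G) :
    (F.card : ℝ) * Module.finrank K (trajectory c E V) ≤
      ((E * F⁻¹).card : ℝ) * Module.finrank K (trajectory c F V) := by
  refine card_mul_le_card_mul_of_submodular
    (f := fun A => (Module.finrank K (trajectory c A V) : ℝ)) ?_ ?_ ?_ ?_ E F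
  · rw [trajectory_empty, finrank_bot, Nat.cast_zero]
  · intro A B
    exact_mod_cast finrank_trajectory_union_add_inter_le A B V
  · intro A B h
    exact Nat.cast_le.2 (Submodule.finrank_mono (trajectory_mono h le_rfl))
  · intro g A
    simp only [finrank_trajectory_smul]

/-- The lower bound is built into the infimum. For the upper bound, compare with a near-optimal `E`
by Shearer's inequality; the factor `|F i * E⁻¹| / |F i|` tends to 1. -/
theorem tendsto_meanDim {I : Type*} [Preorder I] {F : I → Finset G} (hF : IsFolnerNet F)
    (V : Submodule K M) [Module.Finite K V] :
    Tendsto (fun i => (Module.finrank K (trajectory c (F i) V) : ℝ) / (F i).card) atTop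
      (𝓝 (meanDim c V)) := by
  classical
  refine tendsto_order.2 ⟨fun a ha => Eventually.of_forall fun i =>
    ha.trans_le (meanDim_le V (hF.nonempty i)), fun a ha => ?_⟩
  have : Nonempty {F : Finset G // F.Nonempty} := ⟨⟨{1}, Finset.singleton_nonempty 1⟩⟩
  obtain ⟨⟨E, hE⟩, hEa⟩ := exists_lt_of_ciInf_lt ha
  have h := (hF.tendsto_card_mul hE.inv).mul_const
    ((Module.finrank K (trajectory c E V) : ℝ) / E.card)
  rw [one_mul] at h
  filter_upwards [h.eventually_lt_const hEa] with i hi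
  refine lt_of_le_of_lt ?_ hi
  have h1 := hF.card_pos i
  have h2 : (0 : ℝ) < E.card := Nat.cast_pos.2 hE.card_pos
  rw [div_mul_div_comm, div_le_div_iff₀ h1 (by positivity)]
  nlinarith [card_mul_finrank_trajectory_le (c := c) V (F i) E]

theorem meanDim_le_of_tendsto {F : ℕ → Finset G} (hF : IsFolnerNet F) {V : Submodule K M}
    {u : ℕ → ℝ} {b : ℝ} (hu : Tendsto (fun n => u n / (F n).card) atTop (𝓝 b))
    (h : ∀ n, (Module.finrank K (trajectory c (F n) V) : ℝ) ≤ u n) : meanDim c V ≤ b :=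
  ge_of_tendsto' hu fun n => (meanDim_le V (hF.nonempty n)).trans (by gcongr; exact h n)

/-- The trajectory of `W` over `F n` lies in that of `V` over `F n * insert 1 S`. Beyond `F n` this
adds at most `|F n * insert 1 S \ F n| * dim V`, which is `o(|F n|)`. -/
theorem meanDim_le_of_le_trajectory {F : ℕ → Finset G} (hF : IsFolnerNet F)
    {V W : Submodule K M} [Module.Finite K V] {S : Finset G} (h : W ≤ trajectory c S V) :
    meanDim c W ≤ meanDim c V := by
  classical
  have hlim := (tendsto_meanDim (c := c) hF V).add
    (((hF.tendsto_card_mul (Finset.insert_nonempty 1 S)).sub_const 1).mul_const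
      (Module.finrank K V : ℝ))
  rw [sub_self, zero_mul, add_zero] at hlim
  refine meanDim_le_of_tendsto hF (u := fun n => Module.finrank K (trajectory c (F n) V) +
    (((F n * insert 1 S).card : ℝ) - (F n).card) * Module.finrank K V) ?_ fun n => ?_
  · refine hlim.congr fun n => ?_
    have := (hF.card_pos n).ne'
    field_simp
  · have hsub : F n ⊆ F n * insert 1 S :=
      Finset.subset_mul_left _ (Finset.mem_insert_self 1 S)
    have h1 : trajectory c (F n) W ≤
        trajectory c (F n) V ⊔ trajectory c ((F n * insert 1 S) \ F n) V := by
      rw [← trajectory_union, Finset.union_sdiff_of_subset hsub, ← trajectory_trajectory]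
      exact trajectory_mono subset_rfl
        (h.trans (trajectory_mono (Finset.subset_insert _ _) le_rfl))
    have h2 := (Submodule.finrank_mono h1).trans
      (Submodule.finrank_add_le_finrank_add_finrank _ _)
    have h3 := h2.trans (Nat.add_le_add_left
      (finrank_trajectory_le ((F n * insert 1 S) \ F n) V) _)
    rw [Finset.card_sdiff_of_subset hsub] at h3
    rw [← Nat.cast_sub (Finset.card_le_card hsub)]
    exact_mod_cast h3

/-- Adding a vector that is torsion modulo the module generated by `V` does not increase the
mean dimension. -/
theorem meanDim_sup_span_singleton_le {F : ℕ → Finset G} (hF : IsFolnerNet F)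
    {V : Submodule K M} [Module.Finite K V] {x : CrossedProduct c}
    (hx : ∀ A : Finset G, Module.finrank K (trajectory c A (Submodule.span K {x})) = A.card)
    {w : M} (hw : x • w ∈ Submodule.span (CrossedProduct c) (V : Set M)) :
    meanDim c (V ⊔ Submodule.span K {w}) ≤ meanDim c V := by
  classical
  obtain ⟨S, hS⟩ := exists_mem_trajectory hw
  -- Enlarging `V` to contain `x • w` costs nothing, since `V'` is a trajectory of `V`.
  set V' := trajectory c (insert 1 S) V
  have hVV' : V ≤ V' := fun m hm => by
    have h := of_smul_mem_trajectory (c := c) (Finset.mem_insert_self 1 S) hm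
    rwa [show of c 1 = (1 : CrossedProduct c) from rfl, one_smul] at h
  have hwV' : x • w ∈ V' := trajectory_mono (Finset.subset_insert _ _) le_rfl hS
  refine le_trans ?_ (meanDim_le_of_le_trajectory hF (W := V') le_rfl)
  have hlim := ((tendsto_meanDim (c := c) hF V').add_const 1).sub (hF.tendsto_card_core (supp x))
  rw [add_sub_cancel_right] at hlim
  refine meanDim_le_of_tendsto hF (u := fun n => Module.finrank K (trajectory c (F n) V') +
    (F n).card - (core (supp x) (F n)).card) (hlim.congr fun n => ?_) fun n => ?_
  · have := (hF.card_pos n).ne'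
    field_simp
  -- Over the core of `F n` the trajectory of `x • w` is already present, and `x` has full growth
  -- there. So `w` adds at most `|F n| - |core|` dimensions, which is `o(|F n|)`.
  · have h1 := finrank_sup_trajectory_add_finrank_le (c := c) (w := w)
      (core_mul_subset (supp x) (F n)) (B := trajectory c (F n) V')
      (trajectory_mono (core_subset _ _) ((Submodule.span_singleton_le_iff_mem _ _).2 hwV'))
    rw [hx, ← trajectory_sup] at h1
    have h2 := Submodule.finrank_mono (R := K)
      (trajectory_mono (c := c) (subset_refl (F n)) (sup_le_sup_right hVV' (Submodule.span K {w})))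
    rw [le_sub_iff_add_le]
    exact_mod_cast (Nat.add_le_add_right h2 _).trans h1

theorem finrank_trajectory_of_ne_zero [NoZeroDivisors (CrossedProduct c)] {x : CrossedProduct c}
    (hx : x ≠ 0) (A : Finset G) :
    Module.finrank K (trajectory c A (Submodule.span K {x})) = A.card :=
  finrank_trajectory_span_singleton
    (fun _ hy => (mul_eq_zero.1 hy).resolve_right hx) A

theorem meanDim_sup_span_le [NoZeroDivisors (CrossedProduct c)] {F : ℕ → Finset G}
    (hF : IsFolnerNet F) {V : Submodule K M} [Module.Finite K V] {t : Set M} (ht : t.Finite)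
    (h : ∀ w ∈ t, ∃ x : CrossedProduct c, x ≠ 0 ∧
      x • w ∈ Submodule.span (CrossedProduct c) (V : Set M)) :
    meanDim c (V ⊔ Submodule.span K t) ≤ meanDim c V := by
  induction t, ht using Set.Finite.induction_on with
  | empty => simp
  | @insert w t _ ht ih =>
    have := FiniteDimensional.span_of_finite K ht
    obtain ⟨x, hx, hxw⟩ := h w (Set.mem_insert _ _)
    refine le_trans ?_ (ih fun w hw => h w (Set.mem_insert_of_mem _ hw))
    rw [Submodule.span_insert, sup_comm (Submodule.span K {w}), ← sup_assoc]
    refine meanDim_sup_span_singleton_le hF (finrank_trajectory_of_ne_zero hx)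
      (Submodule.span_mono ?_ hxw)
    exact le_sup_left (a := V)

theorem meanDim_span_range_le {ι : Type*} [Fintype ι] (b : ι → M) :
    meanDim c (Submodule.span K (Set.range b)) ≤ Fintype.card ι := by
  refine (meanDim_le _ (Finset.singleton_nonempty 1)).trans ?_
  have := finrank_trajectory_span_range_le (c := c) {1} b
  rw [Finset.card_singleton, one_mul] at this
  rw [Finset.card_singleton, Nat.cast_one, div_one]
  exact_mod_cast this

theorem meanDim_span_range {ι : Type*} [Fintype ι] {b : ι → M}
    (hb : LinearIndependent (CrossedProduct c) b) :
    meanDim c (Submodule.span K (Set.range b)) = Fintype.card ι := by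
  refine le_antisymm (meanDim_span_range_le b) (le_meanDim fun F _ => ?_)
  rw [finrank_trajectory_span_range hb]
  push_cast
  rw [mul_comm]

/-- If the crossed product has no zero divisors, mean dimensions are natural numbers. -/
theorem exists_nat_meanDim_eq [NoZeroDivisors (CrossedProduct c)] {F : ℕ → Finset G}
    (hF : IsFolnerNet F) (V : Submodule K M) [Module.Finite K V] : ∃ n : ℕ, meanDim c V = n := by
  classical
  obtain ⟨k, b, -, rfl⟩ := exists_fin_span_eq V
  -- By maximality every remaining `b i` is torsion modulo the span of `b '' s`, so it does not
  -- change the mean dimension `|s|`.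
  obtain ⟨s, hs, hmax⟩ := exists_maximal_linearIndepOn (CrossedProduct c) b
  have hrange : Set.range (fun i : s => b i) = b '' s := by
    rw [Set.image_eq_range]
  have hV := meanDim_span_range (K := K) hs
  rw [hrange] at hV
  refine ⟨Fintype.card s, le_antisymm ?_ ?_⟩
  · have : Module.Finite K (Submodule.span K (b '' s)) :=
      FiniteDimensional.span_of_finite K (Set.toFinite _)
    refine le_trans ?_ ((meanDim_sup_span_le hF (V := Submodule.span K (b '' s))
      (Set.finite_range b) ?_).trans hV.le)
    · exact meanDim_mono le_sup_right
    · rintro _ ⟨i, rfl⟩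
      by_cases hi : i ∈ s
      · refine ⟨1, one_ne_zero, ?_⟩
        rw [one_smul]
        exact Submodule.subset_span (Submodule.subset_span ⟨i, hi, rfl⟩)
      · obtain ⟨x, hx, hxi⟩ := hmax i hi
        exact ⟨x, hx, Submodule.span_mono Submodule.subset_span hxi⟩
  · rw [← hV]
    exact meanDim_mono (Submodule.span_mono (Set.image_subset_range _ _))

end MeanDim

/-! ### Entropy in terms of mean dimension. -/

section Entropy

variable {K : Type u} [DivisionRing K] {G : Type v} [Group G] {c : CrossedSystem K G}
  {M : Type w} [AddCommGroup M] [Module (CrossedProduct c) M]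
  [Module K M] [IsScalarTower K (CrossedProduct c) M] {F : ℕ → Finset G}

theorem tendsto_dimRatio (hF : IsFolnerNet F) (V : Submodule K M) [Module.Finite K V] :
    Tendsto (fun n => dimRatio c V (F n)) atTop (𝓝 (ENNReal.ofReal (meanDim c V))) := by
  refine (ENNReal.tendsto_ofReal (tendsto_meanDim hF V)).congr fun n => ?_
  rw [ENNReal.ofReal_div_of_pos (hF.card_pos n), ENNReal.ofReal_natCast, ENNReal.ofReal_natCast]
  rfl

theorem entWith_eq (hF : IsFolnerNet F) (V : Submodule K M) [Module.Finite K V] :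
    entWith c F V = ENNReal.ofReal (meanDim c V) :=
  (tendsto_dimRatio hF V).limUnder_eq

theorem entDim_le (hF : IsFolnerNet F) {a : ℝ≥0∞}
    (h : ∀ (V : Submodule K M) [Module.Finite K V], ENNReal.ofReal (meanDim c V) ≤ a) :
    entDim c F M ≤ a :=
  iSup₂_le fun V _ => (entWith_eq hF V).trans_le (h V)

theorem le_entDim (hF : IsFolnerNet F) (V : Submodule K M) [hV : Module.Finite K V] :
    ENNReal.ofReal (meanDim c V) ≤ entDim c F M :=
  (entWith_eq hF V).symm.trans_le (le_iSup₂ (f := fun V _ => entWith c F V) V hV)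

/-- The entropy of a module is computed by a finite dimensional generating subspace. -/
theorem entDim_eq_of_span_eq_top (hF : IsFolnerNet F) (V : Submodule K M) [Module.Finite K V]
    (hV : Submodule.span (CrossedProduct c) (V : Set M) = ⊤) :
    entDim c F M = ENNReal.ofReal (meanDim c V) := by
  refine le_antisymm (entDim_le hF fun W hW => ENNReal.ofReal_le_ofReal ?_) (le_entDim hF V)
  obtain ⟨S, hS⟩ := exists_le_trajectory (c := c) (V := V)
    (Module.Finite.iff_fg.1 hW) (by rw [hV]; exact fun _ _ => trivial)
  exact meanDim_le_of_le_trajectory hF hS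

theorem natCast_le_entDim (hF : IsFolnerNet F) {n : ℕ} {b : Fin n → M}
    (hb : LinearIndependent (CrossedProduct c) b) : (n : ℝ≥0∞) ≤ entDim c F M := by
  have := FiniteDimensional.span_of_finite K (Set.finite_range b)
  have h := le_entDim (c := c) hF (Submodule.span K (Set.range b))
  rwa [meanDim_span_range hb, Fintype.card_fin, ENNReal.ofReal_natCast] at h

theorem entDim_eq_card_of_basis (hF : IsFolnerNet F) {n : ℕ}
    (b : Module.Basis (Fin n) (CrossedProduct c) M) : entDim c F M = n := by
  have := FiniteDimensional.span_of_finite K (Set.finite_range b)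
  rw [entDim_eq_of_span_eq_top hF (Submodule.span K (Set.range b)),
    meanDim_span_range b.linearIndependent, Fintype.card_fin, ENNReal.ofReal_natCast]
  exact top_le_iff.1 (b.span_eq.symm.trans_le (Submodule.span_mono Submodule.subset_span))

end Entropy

end CrossedProduct

/-! ### Bounds for cyclic modules. -/

namespace CrossedProduct

open scoped Pointwise

variable {K : Type u} [DivisionRing K] {G : Type v} [Group G] {c : CrossedSystem K G}
  {F : ℕ → Finset G}

section Cyclic

variable (I : Submodule (CrossedProduct c) (CrossedProduct c))

theorem entDim_quotient (hF : IsFolnerNet F) :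
    entDim c F (CrossedProduct c ⧸ I) =
      ENNReal.ofReal (meanDim c (Submodule.span K {I.mkQ 1})) := by
  refine entDim_eq_of_span_eq_top hF _ (top_le_iff.1 fun q _ => ?_)
  obtain ⟨x, rfl⟩ := I.mkQ_surjective q
  have : I.mkQ x = x • I.mkQ 1 := by rw [← map_smul, smul_eq_mul, mul_one]
  rw [this]
  exact Submodule.smul_mem _ _ (Submodule.subset_span (Submodule.mem_span_singleton_self _))

variable {I}

/-- Right multiplication by `y` factors through the quotient and sends the class of `1` to `y`,
whose trajectories have dimension at least `|F| / |supp y|`. -/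
theorem inv_card_supp_le_meanDim_quotient {y : CrossedProduct c} (hy : y ≠ 0)
    (hI : ∀ z ∈ I, z * y = 0) :
    ((supp y).card : ℝ)⁻¹ ≤ meanDim c (Submodule.span K {I.mkQ 1}) := by
  let f : (CrossedProduct c ⧸ I) →ₗ[CrossedProduct c] CrossedProduct c :=
    I.liftQ (LinearMap.toSpanSingleton _ _ y) fun z hz => by simpa using hI z hz
  have hf : f (I.mkQ 1) = y := by simp [f]
  refine le_meanDim fun F _ => ?_
  have h := Submodule.finrank_map_le (f.restrictScalars K)
    (trajectory c F (Submodule.span K {I.mkQ 1}))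
  rw [map_trajectory, Submodule.map_span, Set.image_singleton, LinearMap.coe_restrictScalars,
    hf] at h
  have hpos : (0 : ℝ) < (supp y).card := Nat.cast_pos.2 (supp_nonempty hy).card_pos
  rw [inv_mul_le_iff₀ hpos]
  exact_mod_cast (card_le_card_supp_mul_finrank hy F).trans (Nat.mul_le_mul_left _ h)

/-- The relation `x • 1 = 0` in the quotient removes the trajectory of `x` over the core of `F n`,
of dimension at least `|core| / |supp x|`. -/
theorem meanDim_quotient_le (hF : IsFolnerNet F) {x : CrossedProduct c} (hx : x ≠ 0)
    (hxI : x ∈ I) :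
    meanDim c (Submodule.span K {I.mkQ 1}) ≤ 1 - ((supp x).card : ℝ)⁻¹ := by
  classical
  have hpos : (0 : ℝ) < (supp x).card := Nat.cast_pos.2 (supp_nonempty hx).card_pos
  have hlim := ((hF.tendsto_card_core (supp x)).mul_const ((supp x).card : ℝ)⁻¹).const_sub 1
  rw [one_mul] at hlim
  refine meanDim_le_of_tendsto hF
    (u := fun n => (F n).card - (core (supp x) (F n)).card * ((supp x).card : ℝ)⁻¹)
    (hlim.congr fun n => ?_) fun n => ?_
  · have := (hF.card_pos n).ne'
    field_simp
  · have hzero : x • I.mkQ 1 = 0 := by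
      rw [← map_smul, smul_eq_mul, mul_one]
      simpa using hxI
    have h1 := finrank_sup_trajectory_add_finrank_le (c := c) (w := I.mkQ 1)
      (core_mul_subset (supp x) (F n)) (B := ⊥) (trajectory_span_le_iff.2 (by
        rintro g - _ rfl
        rw [hzero, smul_zero]
        exact Submodule.zero_mem _))
    rw [bot_sup_eq, finrank_bot, zero_add] at h1
    have h2 := card_le_card_supp_mul_finrank hx (core (supp x) (F n))
    rw [le_sub_iff_add_le]
    refine le_trans (add_le_add_right ?_ _) (Nat.cast_le.2 h1 |>.trans_eq' (Nat.cast_add _ _))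
    rw [mul_inv_le_iff₀ hpos, mul_comm]
    exact_mod_cast h2

end Cyclic

/-! ### Domains and integrality of the entropy. -/

section Domain

theorem exists_mul_eq_zero_of_not_isDomain (h : ¬ IsDomain (CrossedProduct c)) :
    ∃ x y : CrossedProduct c, x ≠ 0 ∧ y ≠ 0 ∧ x * y = 0 := by
  by_contra! hne
  have : NoZeroDivisors (CrossedProduct c) :=
    ⟨fun {a b} hab => by
      by_contra! h
      exact hne a b h.1 h.2 hab⟩
  exact h (NoZeroDivisors.to_isDomain _)

theorem isDomain_of_entDim_quotient_eq_zero (hF : IsFolnerNet F)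
    (h : ∀ I : Submodule (CrossedProduct c) (CrossedProduct c), I ≠ ⊥ →
      entDim c F (CrossedProduct c ⧸ I) = 0) : IsDomain (CrossedProduct c) := by
  by_contra hdom
  obtain ⟨x, y, hx, hy, hxy⟩ := exists_mul_eq_zero_of_not_isDomain hdom
  let I := LinearMap.ker (LinearMap.toSpanSingleton (CrossedProduct c) (CrossedProduct c) y)
  have hI : ∀ z, z ∈ I ↔ z * y = 0 := fun z => by simp [I]
  have h0 := h I ((Submodule.ne_bot_iff I).2 ⟨x, (hI x).2 hxy, hx⟩)
  rw [entDim_quotient I hF, ENNReal.ofReal_eq_zero] at h0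
  have h1 := inv_card_supp_le_meanDim_quotient hy (fun z hz => (hI z).1 hz)
  have hpos : (0 : ℝ) < (supp y).card := Nat.cast_pos.2 (supp_nonempty hy).card_pos
  exact absurd (h1.trans h0) (not_le.2 (inv_pos.2 hpos))

theorem ofReal_notMem_natOrTop {a : ℝ} (h0 : 0 < a) (h1 : a < 1) :
    ENNReal.ofReal a ∉ natOrTop := by
  rintro (⟨n, hn⟩ | h)
  · simp only at hn
    rw [← ENNReal.ofReal_natCast, ENNReal.ofReal_eq_ofReal_iff n.cast_nonneg h0.le] at hn
    rw [← hn] at h0 h1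
    have : 0 < n := by exact_mod_cast h0
    have : n < 1 := by exact_mod_cast h1
    omega
  · exact ENNReal.ofReal_ne_top h

theorem isDomain_of_entDimValues_subset (hF : IsFolnerNet F)
    (h : entDimValues c F ⊆ natOrTop) : IsDomain (CrossedProduct c) := by
  by_contra hdom
  obtain ⟨x, y, hx, hy, hxy⟩ := exists_mul_eq_zero_of_not_isDomain hdom
  let I := LinearMap.ker (LinearMap.toSpanSingleton (CrossedProduct c) (CrossedProduct c) y)
  have hI : ∀ z, z ∈ I ↔ z * y = 0 := fun z => by simp [I]
  have h1 := inv_card_supp_le_meanDim_quotient hy (fun z hz => (hI z).1 hz)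
  have h2 := meanDim_quotient_le hF hx ((hI x).2 hxy)
  have hposx : (0 : ℝ) < (supp x).card := Nat.cast_pos.2 (supp_nonempty hx).card_pos
  have hposy : (0 : ℝ) < (supp y).card := Nat.cast_pos.2 (supp_nonempty hy).card_pos
  have hmem : entDim c F (CrossedProduct c ⧸ I) ∈ natOrTop :=
    h ⟨CrossedProduct c ⧸ I, inferInstance, inferInstance, inferInstance, inferInstance, rfl⟩
  rw [entDim_quotient I hF] at hmem
  exact ofReal_notMem_natOrTop ((inv_pos.2 hposy).trans_le h1)
    (h2.trans_lt (sub_lt_self _ (inv_pos.2 hposx))) hmem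

/-- The coercion from the complete lattice `ℕ∞` preserves suprema. Indexing by a `Sort` also covers
the supremum over proofs of finiteness in `entDim`; an empty one is 0. -/
theorem iSup_mem_natOrTop {ι : Sort*} {f : ι → ℝ≥0∞} (hf : ∀ i, f i ∈ natOrTop) :
    ⨆ i, f i ∈ natOrTop := by
  have h : ∀ i, ∃ m : ℕ∞, (m : ℝ≥0∞) = f i := by
    intro i
    rcases hf i with ⟨n, hn⟩ | htop
    · exact ⟨n, by simpa using hn⟩
    · exact ⟨⊤, by simpa using htop.symm⟩
  choose m hm using h
  have : ⨆ i, f i = ((⨆ i, m i : ℕ∞) : ℝ≥0∞) := by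
    rw [ENat.toENNReal_iSup]
    simp only [hm]
  rw [this]
  induction (⨆ i, m i) using ENat.recTopCoe with
  | top => right; simp
  | coe n => left; exact ⟨n, by simp⟩

theorem entDimValues_subset_of_isDomain (hF : IsFolnerNet F) [IsDomain (CrossedProduct c)] :
    entDimValues c F ⊆ natOrTop := by
  rintro _ ⟨M, _, _, _, _, rfl⟩
  refine iSup_mem_natOrTop fun V => iSup_mem_natOrTop fun hV => ?_
  obtain ⟨n, hn⟩ := exists_nat_meanDim_eq (c := c) hF V
  rw [entWith_eq hF, hn, ENNReal.ofReal_natCast]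
  exact Or.inl ⟨n, rfl⟩

/-- Free modules of rank `n` and of countably infinite rank realize the values, whether or not there
are zero divisors. -/
theorem natOrTop_subset_entDimValues (hF : IsFolnerNet F) : natOrTop ⊆ entDimValues c F := by
  rintro _ (⟨n, rfl⟩ | rfl)
  · exact ⟨Fin n → CrossedProduct c, inferInstance, inferInstance, inferInstance, inferInstance,
      entDim_eq_card_of_basis hF (Pi.basisFun _ _)⟩
  · refine ⟨ℕ →₀ CrossedProduct c, inferInstance, inferInstance, inferInstance, inferInstance, ?_⟩
    refine ENNReal.eq_top_of_forall_nnreal_le fun r => ?_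
    obtain ⟨n, hn⟩ := exists_nat_ge r
    refine le_trans ?_ (natCast_le_entDim (c := c) hF
      ((Finsupp.linearIndependent_single_one (CrossedProduct c) ℕ).comp (fun i : Fin n => (i : ℕ))
        Fin.val_injective))
    exact_mod_cast hn

end Domain

/-! ### Ore conditions. -/

section Ore

theorem isLeftOreDomain_of_isDomain (hF : IsFolnerNet F) [hD : IsDomain (CrossedProduct c)] :
    IsLeftOreDomain (CrossedProduct c) := by
  refine ⟨hD, fun x y hx hy => ?_⟩
  have hdep : ¬ LinearIndependent (CrossedProduct c) ![x, y] := by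
    intro h
    have h1 := natCast_le_entDim hF h
    rw [entDim_eq_card_of_basis hF (Module.Basis.singleton (Fin 1) (CrossedProduct c))] at h1
    norm_num at h1
  obtain ⟨g, hg, i, hi⟩ := Fintype.not_linearIndependent_iff.1 hdep
  simp only [Fin.sum_univ_two, Matrix.cons_val_zero, Matrix.cons_val_one, smul_eq_mul] at hg
  refine ⟨g 0, -g 1, by rw [neg_mul]; exact eq_neg_of_add_eq_zero_left hg, fun h0 => hi ?_⟩
  rw [h0, zero_add] at hg
  have h0' := (mul_eq_zero.1 h0).resolve_right hx
  have h1' := (mul_eq_zero.1 hg).resolve_right hy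
  fin_cases i
  exacts [h0', h1']

/-- The crossed product as a right vector space over the coefficients. -/
noncomputable instance instModuleMulOpposite : Module Kᵐᵒᵖ (CrossedProduct c) :=
  Module.compHom (CrossedProduct c) (incl c).op

theorem op_smul_eq_mul_incl (k : K) (z : CrossedProduct c) :
    MulOpposite.op k • z = z * incl c k := rfl

theorem op_smul_of (k : K) (g : G) :
    MulOpposite.op k • of c g = c.σ g k • of c g := by
  rw [op_smul_eq_mul_incl, incl_eq_smul_one, of_mul_smul_one]

theorem mul_op_smul (k : Kᵐᵒᵖ) (x y : CrossedProduct c) : x * k • y = k • (x * y) :=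
  (mul_assoc x y _).symm

/-- Moving scalars across `g̲` twists them by the injective `σ_g`, which reduces this to
independence on the left. -/
theorem linearIndependent_op_of : LinearIndependent Kᵐᵒᵖ (of c) := by
  rw [linearIndependent_iff']
  intro s g hg i hi
  have h : ∑ i ∈ s, c.σ i (g i).unop • of c i = 0 := by
    rw [← hg]
    exact Finset.sum_congr rfl fun i _ => (op_smul_of _ _).symm
  have := linearIndependent_iff'.1 (linearIndependent_of (c := c)) s _ h i hi
  simpa using this

theorem mul_of_mem_span_op [DecidableEq G] {x : CrossedProduct c} {S E : Finset G}
    (hx : supp x ⊆ S) {g : G} (hg : g ∈ E) :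
    x * of c g ∈ Submodule.span Kᵐᵒᵖ (Set.range fun h : (S * E : Finset G) => of c (h : G)) := by
  rw [← sum_coeff_smul_of x, Finset.sum_mul]
  refine Submodule.sum_mem _ fun h hh => ?_
  rw [smul_mul_assoc, of_mul_of, smul_smul]
  have : ∀ r : K, r • of c (h * g) =
      MulOpposite.op ((c.σ (h * g)).symm r) • of c (h * g) := by
    intro r
    rw [op_smul_of, RingEquiv.apply_symm_apply]
  rw [this]
  exact Submodule.smul_mem _ _ (Submodule.subset_span
    ⟨⟨h * g, Finset.mul_mem_mul (hx hh) hg⟩, rfl⟩)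

/-- The `2|E|` elements `x g̲` and `y g̲`, `g ∈ E`, lie in a right space of dimension at most `|S E|
< 2|E|`. A dependence among them is a common right multiple, nonzero since cancellation would
otherwise kill all coefficients. -/
theorem isRightOreDomain_of_isDomain (hF : IsFolnerNet F) [hD : IsDomain (CrossedProduct c)] :
    IsRightOreDomain (CrossedProduct c) := by
  classical
  refine ⟨hD, fun x y hx hy => ?_⟩
  set S := supp x ∪ supp y
  have hSne : S.Nonempty := (supp_nonempty hx).mono Finset.subset_union_left
  obtain ⟨n, hn⟩ := ((hF.tendsto_card_mul hSne.inv).eventually_lt_const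
    (by norm_num : (1 : ℝ) < 2)).exists
  rw [div_lt_iff₀ (hF.card_pos n)] at hn
  -- Inversion turns the almost right invariance of `F n` into the almost left invariance needed for
  -- `S * E`.
  set E := (F n)⁻¹ with hE
  have hcard : (S * E).card < 2 * E.card := by
    have : S * E = (F n * S⁻¹)⁻¹ := by rw [mul_inv_rev, inv_inv]
    rw [this, Finset.card_inv, hE, Finset.card_inv]
    exact_mod_cast hn
  let W := Submodule.span Kᵐᵒᵖ (Set.range fun h : (S * E : Finset G) => of c (h : G))
  have : Module.Finite Kᵐᵒᵖ W := FiniteDimensional.span_of_finite _ (Set.finite_range _)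
  have hW : Module.finrank Kᵐᵒᵖ W ≤ (S * E).card :=
    (finrank_range_le_card (R := Kᵐᵒᵖ) fun h : (S * E : Finset G) => of c (h : G)).trans_eq
      (Fintype.card_coe _)
  let b : E ⊕ E → W := Sum.elim
    (fun g => ⟨x * of c g, mul_of_mem_span_op Finset.subset_union_left g.2⟩)
    (fun g => ⟨y * of c g, mul_of_mem_span_op Finset.subset_union_right g.2⟩)
  have hdep : ¬ LinearIndependent Kᵐᵒᵖ b := by
    intro h
    have := h.fintype_card_le_finrank
    rw [Fintype.card_sum, Fintype.card_coe] at this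
    omega
  obtain ⟨r, hr, i, hi⟩ := Fintype.not_linearIndependent_iff.1 hdep
  have hr' := congrArg (Subtype.val) hr
  rw [Fintype.sum_sum_type] at hr'
  simp only [b, Sum.elim_inl, Sum.elim_inr, Submodule.coe_add, Submodule.coe_sum,
    Submodule.coe_smul, ← mul_op_smul, ← Finset.mul_sum, Submodule.coe_zero] at hr'
  have hindep := Fintype.linearIndependent_iff.1
    ((linearIndependent_op_of (c := c)).comp (Subtype.val : E → G) Subtype.val_injective)
  refine ⟨∑ g : E, r (Sum.inl g) • of c (g : G), -∑ g : E, r (Sum.inr g) • of c (g : G),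
    by rw [mul_neg]; exact eq_neg_of_add_eq_zero_left hr', fun h0 => hi ?_⟩
  rw [h0, zero_add] at hr'
  have h0' := hindep _ ((mul_eq_zero.1 h0).resolve_left hx)
  have h1' := hindep _ ((mul_eq_zero.1 hr').resolve_left hy)
  rcases i with i | i
  exacts [h0' i, h1' i]

theorem entDim_quotient_eq_zero_of_isLeftOreDomain (hF : IsFolnerNet F)
    (hD : IsLeftOreDomain (CrossedProduct c))
    {I : Submodule (CrossedProduct c) (CrossedProduct c)} (hI : I ≠ ⊥) :
    entDim c F (CrossedProduct c ⧸ I) = 0 := by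
  have := hD.1
  obtain ⟨x, hxI, hx⟩ := I.ne_bot_iff.1 hI
  rw [entDim_quotient I hF, ENNReal.ofReal_eq_zero]
  have hzero : x • I.mkQ 1 = 0 := by
    rw [← map_smul, smul_eq_mul, mul_one]
    simpa using hxI
  -- The class of `1` is torsion already over the zero subspace, whose mean dimension is bounded by
  -- the size of the empty family.
  have h := meanDim_sup_span_singleton_le hF (V := ⊥) (finrank_trajectory_of_ne_zero hx)
    (w := I.mkQ 1) (by rw [hzero]; exact Submodule.zero_mem _)
  rw [bot_sup_eq] at h
  refine h.trans ?_
  simpa using meanDim_span_range_le (K := K) (c := c)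
    (fun i : Fin 0 => (i.elim0 : CrossedProduct c ⧸ I))

end Ore

end CrossedProduct

theorem theorem7p10 {K : Type u} [DivisionRing K] {G : Type v} [Group G] [Group.FG G]
    (hG : IsAmenableGroup G) (c : CrossedSystem K G) :
    -- the entropy is well defined: there are Følner sequences, and the limits defining the entropy
    -- exist, are finite and do not depend on the Følner sequence
    (∃ F : ℕ → Finset G, IsFolnerNet F) ∧
    (∀ (M : Type (max u v)) [AddCommGroup M] [Module (CrossedProduct c) M] [Module K M]
        [IsScalarTower K (CrossedProduct c) M] (V : Submodule K M), Module.Finite K V →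
      ∃ a : ℝ≥0, ∀ F : ℕ → Finset G, IsFolnerNet F →
        Tendsto (fun n => CrossedProduct.dimRatio c V (F n)) atTop (𝓝 (a : ℝ≥0∞))) ∧
    -- the equivalence
    ∀ F : ℕ → Finset G, IsFolnerNet F →
      List.TFAE [
        IsLeftOreDomain (CrossedProduct c) ∧ IsRightOreDomain (CrossedProduct c),
        IsDomain (CrossedProduct c),
        ∀ I : Submodule (CrossedProduct c) (CrossedProduct c), I ≠ ⊥ →
          CrossedProduct.entDim c F (CrossedProduct c ⧸ I) = 0,
        CrossedProduct.entDimValues c F ⊆ natOrTop,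
        CrossedProduct.entDimValues c F = natOrTop] := by
  have := Group.FG.countable G
  obtain ⟨F₀, hF₀⟩ := hG.exists_seq
  refine ⟨⟨F₀, hF₀⟩, ?_, ?_⟩
  · intro M _ _ _ _ V hV
    exact ⟨(CrossedProduct.meanDim c V).toNNReal,
      fun F hF => CrossedProduct.tendsto_dimRatio hF V⟩
  · intro F hF
    tfae_have 1 → 2 := fun h => h.1.1
    tfae_have 2 → 1 := fun h =>
      ⟨CrossedProduct.isLeftOreDomain_of_isDomain hF, CrossedProduct.isRightOreDomain_of_isDomain hF⟩
    tfae_have 1 → 3 := fun h I hI =>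
      CrossedProduct.entDim_quotient_eq_zero_of_isLeftOreDomain hF h.1 hI
    tfae_have 3 → 2 := CrossedProduct.isDomain_of_entDim_quotient_eq_zero hF
    tfae_have 2 → 4 := fun h => CrossedProduct.entDimValues_subset_of_isDomain hF
    tfae_have 4 → 2 := CrossedProduct.isDomain_of_entDimValues_subset hF
    tfae_have 4 → 5 := fun h => h.antisymm (CrossedProduct.natOrTop_subset_entDimValues hF)
    tfae_have 5 → 4 := fun h => h.le
    tfae_finish
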